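/- Let $m_2<m_1$ be nonnegative integers and put $n=m_1+m_2+1$; let $\pi_n$ denote the real polynomials of degree at most $n$. Let $f,g\in C^{n+2}(0,\infty)$ be real-valued functions such that $f^{(n+1)}(x)\neq 0$ and $g^{(n+1)}(x)\neq 0$ for all $x>0$. For $h\in\{f,g\}$ and $a,b>0$ with $a\neq b$, let $P,Q\in\pi_n$ be the Hermite interpolants of $h$ determined by $$P^{(j)}(a)=h^{(j)}(a)\ (0\le j\le m_1),\quad P^{(j)}(b)=h^{(j)}(b)\ (0\le j\le m_2),$$ $$Q^{(j)}(a)=h^{(j)}(a)\ (0\le j\le m_2),\quad Q^{(j)}(b)=h^{(j)}(b)\ (0\le j\le m_1),$$ and let $M_{h,m_1,m_2}(a,b)$ be the unique $x$ strictly between $a$ and $b$ with $$h(x)-P(x)=(-1)^{m_1-m_2}\,(h(x)-Q(x)),$$ that is, $P(x)=Q(x)$ if $m_1-m_2$ is even and $h(x)=\tfrac12(P(x)+Q(x))$ if $m_1-m_2$ is odd; put $M_{h,m_1,m_2}(a,a)=a$. Then $M_{f,m_1,m_2}(a,b)=M_{g,m_1,m_2}(a,b)$ for all $a,b>0$ if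 and only if there are a constant $c\in\mathbb{R}$ and a polynomial $p\in\pi_n$ with $g(x)=cf(x)+p(x)$ for all $x>0$. -/

import Mathlib

open Polynomial

namespace HermiteMeans

/-- `P` is the Hermite interpolant of `f` in `π_{k+l+1}` that matches the derivatives of `f` of
orders `0, …, k` at `a` and of orders `0, …, l` at `b`. -/
def IsHermiteInterpolant (f : ℝ → ℝ) (k l : ℕ) (a b : ℝ) (P : ℝ[X]) : Prop :=
  P.natDegree ≤ k + l + 1 ∧
    (∀ j ≤ k, (derivative^[j] P).eval a = iteratedDeriv j f a) ∧
    (∀ j ≤ l, (derivative^[j] P).eval b = iteratedDeriv j f b)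

/-- `x` lies strictly between `a` and `b` and solves `E_P(x) = (-1)^(m₁-m₂) E_Q(x)`, where
`E_P = f - P`, `E_Q = f - Q`. For `m₁ - m₂` even this says `P(x) = Q(x)`, and for `m₁ - m₂` odd it
says `f(x) = (P(x) + Q(x)) / 2`. The condition is symmetric in `a` and `b`, because exchanging `a`
and `b` exchanges `P` and `Q`. -/
def IsMeanPoint (f : ℝ → ℝ) (m₁ m₂ : ℕ) (a b x : ℝ) : Prop :=
  min a b < x ∧ x < max a b ∧
    ∃ P Q : ℝ[X], IsHermiteInterpolant f m₁ m₂ a b P ∧ IsHermiteInterpolant f m₂ m₁ a b Q ∧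
      f x - P.eval x = (-1) ^ (m₁ - m₂) * (f x - Q.eval x)

/-- The mean `M_{f,m₁,m₂}(a,b)`: for `a ≠ b` it is the solution `x` of `IsMeanPoint f m₁ m₂ a b x`
(which exists and is unique when `m₂ < m₁` and the derivative of `f` of order `m₁+m₂+2` does
not vanish), and `M_{f,m₁,m₂}(a,a) = a`. -/
noncomputable def hermiteMean (f : ℝ → ℝ) (m₁ m₂ : ℕ) (a b : ℝ) : ℝ :=
  if a = b then a else Classical.epsilon (IsMeanPoint f m₁ m₂ a b)

end HermiteMeans

/-! Put N = m₁+m₂+2 and d = m₁-m₂. A Hermite error is its node polynomial times h^(N)(ξ)/N!, so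
after cancelling common factors the mean equation reads (x-a)^d h^(N)(ξ) = (b-x)^d h^(N)(η). With T
= (x-a)/(b-a), letting b → a⁺ gives only T^d - (1-T)^d → 0, whatever h is; the next order tells
functions apart.

Fix a and choose c so that v = g - c f has v^(N)(a) = 0. The mean equation is linear in h, so a
common mean point also satisfies it for v. Write v^(N)(y) = B (N+1)! (y-a) + o(y-a). An error
formula with a linear main term (`exists_hermite_error_of_natDegree_le`) then gives T^d (B(T+m₂+1) +
o(1)) = (1-T)^d (B(T+m₁+1) + o(1)). Since m₁ ≠ m₂, B ≠ 0 would force T^d → 0 and (1-T)^d → 0, which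
is absurd (`coeff_eq_zero_of_mean_equations`). Hence B = 0 for every a, so g^(N)/f^(N) is constant
and g - c f is a polynomial in π_n.

Conversely, interpolation is linear and reproduces π_n, so f and c f + p with c ≠ 0 have the same
mean points. -/

namespace HermiteMeans

/-! ### Towers of derivatives -/

/-- `v 0, …, v N` are successive derivatives on `s`. -/
def IsDerivTower (N : ℕ) (s : Set ℝ) (v : ℕ → ℝ → ℝ) : Prop :=
  ∀ j < N, ∀ x ∈ s, HasDerivAt (v j) (v (j + 1) x) x

theorem IsDerivTower.mono {N : ℕ} {s t : Set ℝ} {v : ℕ → ℝ → ℝ} (h : IsDerivTower N t v)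
    (hst : s ⊆ t) : IsDerivTower N s v :=
  fun j hj x hx => h j hj x (hst hx)

theorem IsDerivTower.of_le {N M : ℕ} {s : Set ℝ} {v : ℕ → ℝ → ℝ} (h : IsDerivTower N s v)
    (hMN : M ≤ N) : IsDerivTower M s v :=
  fun j hj x hx => h j (hj.trans_le hMN) x hx

theorem IsDerivTower.sub {N : ℕ} {s : Set ℝ} {v w : ℕ → ℝ → ℝ} (hv : IsDerivTower N s v)
    (hw : IsDerivTower N s w) : IsDerivTower N s (fun j x => v j x - w j x) :=
  fun j hj x hx => (hv j hj x hx).sub (hw j hj x hx)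

theorem IsDerivTower.add {N : ℕ} {s : Set ℝ} {v w : ℕ → ℝ → ℝ} (hv : IsDerivTower N s v)
    (hw : IsDerivTower N s w) : IsDerivTower N s (fun j x => v j x + w j x) :=
  fun j hj x hx => (hv j hj x hx).add (hw j hj x hx)

theorem IsDerivTower.const_mul {N : ℕ} {s : Set ℝ} {v : ℕ → ℝ → ℝ} (c : ℝ)
    (hv : IsDerivTower N s v) : IsDerivTower N s (fun j x => c * v j x) :=
  fun j hj x hx => (hv j hj x hx).const_mul c

theorem isDerivTower_eval (N : ℕ) (s : Set ℝ) (p : ℝ[X]) :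
    IsDerivTower N s (fun j x => (derivative^[j] p).eval x) := fun j _ x _ => by
  simpa only [Function.iterate_succ_apply'] using (derivative^[j] p).hasDerivAt x

theorem isDerivTower_iteratedDeriv {N : ℕ} {s : Set ℝ} (hs : IsOpen s) {f : ℝ → ℝ}
    (hf : ContDiffOn ℝ (N : WithTop ℕ∞) f s) :
    IsDerivTower N s (fun j => iteratedDeriv j f) := by
  intro j hj x hx
  have h1 : DifferentiableOn ℝ (iteratedDerivWithin j f s) s :=
    hf.differentiableOn_iteratedDerivWithin (by exact_mod_cast hj) hs.uniqueDiffOn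
  have h2 : DifferentiableOn ℝ (iteratedDeriv j f) s :=
    h1.congr fun y hy => (iteratedDerivWithin_of_isOpen hs hy).symm
  have h3 := (h2.differentiableAt (hs.mem_nhds hx)).hasDerivAt
  rwa [← iteratedDeriv_succ] at h3

/-! ### Rolle's theorem and counting zeros -/

/-- Rolle's theorem for a finite set of zeros. -/
theorem exists_finset_deriv_zeros {f f' : ℝ → ℝ} {s : Set ℝ} (hs : s.OrdConnected)
    (hf : ∀ x ∈ s, HasDerivAt f (f' x) x) (T : Finset ℝ) (hT : ∀ x ∈ T, x ∈ s ∧ f x = 0) :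
    ∃ S : Finset ℝ, T.card ≤ S.card + 1 ∧
      ∀ z ∈ S, f' z = 0 ∧ (∃ x ∈ T, x < z) ∧ ∃ y ∈ T, z < y := by
  induction T using Finset.induction_on_max with
  | empty => exact ⟨∅, by simp⟩
  | insert m T hm ih =>
    obtain ⟨S, hcard, hS⟩ := ih fun x hx => hT x (Finset.mem_insert_of_mem hx)
    have hmT : m ∉ T := fun h => lt_irrefl _ (hm m h)
    rcases T.eq_empty_or_nonempty with rfl | hne
    · exact ⟨∅, by simp⟩
    · set y := T.max' hne
      have hyT : y ∈ T := T.max'_mem hne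
      have hy := hT y (Finset.mem_insert_of_mem hyT)
      have hm' := hT m (Finset.mem_insert_self _ _)
      have hsub : Set.Icc y m ⊆ s := hs.out hy.1 hm'.1
      obtain ⟨c, hc, hc0⟩ := exists_hasDerivAt_eq_zero (hm y hyT)
        (fun x hx => (hf x (hsub hx)).continuousAt.continuousWithinAt)
        (hy.2.trans hm'.2.symm) (fun x hx => hf x (hsub ⟨hx.1.le, hx.2.le⟩))
      -- Each earlier zero lies below a point of `T`, hence below `y`, while `c` lies above `y`.
      have hcS : c ∉ S := fun h => by
        obtain ⟨-, -, z, hz, hcz⟩ := hS c h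
        exact absurd (hcz.trans_le (T.le_max' z hz)) (not_lt.2 hc.1.le)
      refine ⟨insert c S, ?_, fun z hz => ?_⟩
      · rw [Finset.card_insert_of_notMem hcS, Finset.card_insert_of_notMem hmT]
        omega
      · rcases Finset.mem_insert.1 hz with rfl | hz
        · exact ⟨hc0, ⟨y, Finset.mem_insert_of_mem hyT, hc.1⟩,
            ⟨m, Finset.mem_insert_self _ _, hc.2⟩⟩
        · obtain ⟨h1, ⟨x, hx, hxz⟩, ⟨w, hw, hzw⟩⟩ := hS z hz
          exact ⟨h1, ⟨x, Finset.mem_insert_of_mem hx, hxz⟩,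
            ⟨w, Finset.mem_insert_of_mem hw, hzw⟩⟩

/-- Rolle's theorem for zeros of order `k` at `a`, of order `l` at `b`, and simple zeros `S` in
between. -/
theorem exists_deriv_eq_zero_of_multiple_zeros {a b : ℝ} (hab : a < b) (N : ℕ)
    (v : ℕ → ℝ → ℝ) (k l : ℕ) (S : Finset ℝ) (hv : IsDerivTower N (Set.Icc a b) v)
    (ha : ∀ j < k, v j a = 0) (hb : ∀ j < l, v j b = 0)
    (hS : ∀ x ∈ S, x ∈ Set.Ioo a b ∧ v 0 x = 0) (hne : S.Nonempty)
    (hN : N + 1 ≤ k + l + S.card) :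
    ∃ ξ ∈ Set.Ioo a b, v N ξ = 0 := by
  induction N generalizing v k l S with
  | zero =>
    obtain ⟨x, hx⟩ := hne
    exact ⟨x, hS x hx⟩
  | succ N ih =>
    have haS : a ∉ S := fun h => lt_irrefl _ (hS a h).1.1
    have hbS : b ∉ S := fun h => lt_irrefl _ (hS b h).1.2
    -- An endpoint joins the Rolle points only if its order is positive; this matches the truncated
    -- `k - 1` and `l - 1` below.
    let A : Finset ℝ := if 0 < k then {a} else ∅
    let B : Finset ℝ := if 0 < l then {b} else ∅
    have hA : ∀ x ∈ A, x = a ∧ 0 < k := by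
      intro x hx
      simp only [A] at hx
      split_ifs at hx with h
      · exact ⟨Finset.mem_singleton.1 hx, h⟩
      · simp at hx
    have hB : ∀ x ∈ B, x = b ∧ 0 < l := by
      intro x hx
      simp only [B] at hx
      split_ifs at hx with h
      · exact ⟨Finset.mem_singleton.1 hx, h⟩
      · simp at hx
    have hAc : k ≤ k - 1 + A.card := by
      simp only [A]; split_ifs <;> simp <;> omega
    have hBc : l ≤ l - 1 + B.card := by
      simp only [B]; split_ifs <;> simp <;> omega
    -- These bounds keep `S'` nonempty: if `S` is a single point, then `k + l` is positive and an
    -- endpoint supplies a second zero.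
    have hAc' : k = 0 ∨ 1 ≤ A.card := by
      simp only [A]; split_ifs <;> simp; omega
    have hBc' : l = 0 ∨ 1 ≤ B.card := by
      simp only [B]; split_ifs <;> simp; omega
    have hd1 : Disjoint A B := Finset.disjoint_left.2 fun x hx hx' =>
      hab.ne ((hA x hx).1.symm.trans (hB x hx').1)
    have hd2 : Disjoint (A ∪ B) S := Finset.disjoint_left.2 fun x hx hx' => by
      rcases Finset.mem_union.1 hx with h | h
      · exact haS ((hA x h).1 ▸ hx')
      · exact hbS ((hB x h).1 ▸ hx')
    have hcard : (A ∪ B ∪ S).card = A.card + B.card + S.card := by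
      rw [Finset.card_union_of_disjoint hd2, Finset.card_union_of_disjoint hd1]
    have hTmem : ∀ x ∈ A ∪ B ∪ S, x ∈ Set.Icc a b ∧ v 0 x = 0 := by
      intro x hx
      rcases Finset.mem_union.1 hx with h | h
      · rcases Finset.mem_union.1 h with h | h
        · obtain ⟨rfl, h0⟩ := hA x h
          exact ⟨Set.left_mem_Icc.2 hab.le, ha 0 h0⟩
        · obtain ⟨rfl, h0⟩ := hB x h
          exact ⟨Set.right_mem_Icc.2 hab.le, hb 0 h0⟩
      · exact ⟨Set.Ioo_subset_Icc_self (hS x h).1, (hS x h).2⟩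
    obtain ⟨S', hS'c, hS'⟩ := exists_finset_deriv_zeros Set.ordConnected_Icc
      (hv 0 N.succ_pos) _ hTmem
    have hSpos := hne.card_pos
    -- Differentiation lowers the total count of zeros by at most one.
    exact ih (fun j => v (j + 1)) (k - 1) (l - 1) S'
      (fun j hj => hv (j + 1) (by omega)) (fun j hj => ha (j + 1) (by omega))
      (fun j hj => hb (j + 1) (by omega))
      (fun z hz => by
        obtain ⟨h0, ⟨x, hx, hxz⟩, ⟨y, hy, hzy⟩⟩ := hS' z hz
        exact ⟨⟨(hTmem x hx).1.1.trans_lt hxz, hzy.trans_le (hTmem y hy).1.2⟩, h0⟩)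
      (Finset.card_pos.1 (by omega)) (by omega)

/-! ### Hermite interpolating polynomials -/

theorem eval_iterate_derivative_X_sub_C_pow_mul_of_lt (a : ℝ) (q : ℝ[X]) {j k : ℕ} (h : j < k) :
    (derivative^[j] ((X - C a) ^ k * q)).eval a = 0 := by
  rw [← coe_aeval_eq_eval]
  exact aeval_iterate_derivative_of_lt ((X - C a) ^ k * q) k a (p' := q) (by simp) h

theorem eval_iterate_derivative_X_sub_C_pow_mul_self (a : ℝ) (q : ℝ[X]) (k : ℕ) :
    (derivative^[k] ((X - C a) ^ k * q)).eval a = k.factorial * q.eval a := by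
  rw [← coe_aeval_eq_eval, ← nsmul_eq_mul]
  exact aeval_iterate_derivative_self ((X - C a) ^ k * q) k a (p' := q) (by simp)

theorem degree_X_sub_C_pow_mul_X_sub_C_pow (a b : ℝ) (k l : ℕ) :
    ((X - C a) ^ k * (X - C b) ^ l : ℝ[X]).degree = (k + l : ℕ) := by
  rw [degree_mul, degree_pow, degree_pow, degree_X_sub_C, degree_X_sub_C]
  simp

/-- Newton's scheme: a multiple of (X-a)^k (X-b)^l corrects the derivative of order l at b and
leaves all earlier conditions intact. -/
theorem exists_hermite_polynomial {a b : ℝ} (hab : a ≠ b) (α β : ℕ → ℝ) (k l : ℕ) :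
    ∃ P : ℝ[X], P.degree < (k + l : ℕ) ∧ (∀ j < k, (derivative^[j] P).eval a = α j) ∧
      ∀ j < l, (derivative^[j] P).eval b = β j := by
  have step : ∀ {a b : ℝ}, a ≠ b → ∀ (α β : ℕ → ℝ) (k l : ℕ) (P : ℝ[X]),
      P.degree < (k + l : ℕ) → (∀ j < k, (derivative^[j] P).eval a = α j) →
      (∀ j < l, (derivative^[j] P).eval b = β j) →
      ∃ P : ℝ[X], P.degree < (k + (l + 1) : ℕ) ∧ (∀ j < k, (derivative^[j] P).eval a = α j) ∧
        ∀ j < l + 1, (derivative^[j] P).eval b = β j := by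
    intro a b hab α β k l P hP hPa hPb
    -- The derivative of order l of (X-a)^k (X-b)^l at b.
    set d : ℝ := l.factorial * (b - a) ^ k
    have hd : d ≠ 0 := mul_ne_zero (by positivity) (pow_ne_zero _ (sub_ne_zero.2 hab.symm))
    set c : ℝ := (β l - (derivative^[l] P).eval b) / d
    refine ⟨P + C c * ((X - C a) ^ k * (X - C b) ^ l), ?_, ?_, ?_⟩
    · refine (degree_add_le _ _).trans_lt (max_lt (hP.trans_le ?_) ?_)
      · exact_mod_cast (by omega : k + l ≤ k + (l + 1))
      · rw [← smul_eq_C_mul]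
        refine (degree_smul_le _ _).trans_lt ?_
        rw [degree_X_sub_C_pow_mul_X_sub_C_pow]
        exact_mod_cast (by omega : k + l < k + (l + 1))
    · intro j hj
      rw [iterate_map_add, eval_add, iterate_derivative_C_mul, eval_C_mul,
        eval_iterate_derivative_X_sub_C_pow_mul_of_lt _ _ hj, hPa j hj]
      simp
    · intro j hj
      rw [iterate_map_add, eval_add, iterate_derivative_C_mul, eval_C_mul, mul_comm (_ ^ k)]
      rcases Nat.lt_succ_iff_lt_or_eq.1 hj with h | rfl
      · rw [eval_iterate_derivative_X_sub_C_pow_mul_of_lt _ _ h, hPb j h]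
        simp
      · rw [eval_iterate_derivative_X_sub_C_pow_mul_self]
        have : c * d = β j - (derivative^[j] P).eval b := div_mul_cancel₀ _ hd
        simp only [eval_pow, eval_sub, eval_X, eval_C]
        linarith
  induction l with
  | zero =>
    induction k with
    | zero => exact ⟨0, by simp⟩
    | succ k ih =>
      obtain ⟨P, h1, h2, h3⟩ := ih
      obtain ⟨Q, h4, h5, h6⟩ := step hab.symm β α 0 k P (by simpa using h1) h3 h2
      exact ⟨Q, by simpa using h4, h6, h5⟩
  | succ l ih =>
    obtain ⟨P, h1, h2, h3⟩ := ih
    exact step hab α β k l P h1 h2 h3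

/-- A tower of derivatives on `(0, ∞)` whose top member vanishes consists of derivatives of a
polynomial. -/
theorem exists_polynomial_of_tower_eq_zero {N : ℕ} {v : ℕ → ℝ → ℝ}
    (hv : IsDerivTower N (Set.Ioi 0) v) (hN : ∀ x, 0 < x → v N x = 0) :
    ∃ p : ℝ[X], p.degree < (N : ℕ) ∧ ∀ x, 0 < x → v 0 x = p.eval x := by
  -- The Taylor polynomial at 1; the second node 2 carries no conditions.
  obtain ⟨p, hp, hp1, -⟩ := exists_hermite_polynomial (a := 1) (b := 2) (by norm_num)
    (fun j => v j 1) (fun _ => 0) N 0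
  rw [add_zero] at hp
  refine ⟨p, hp, ?_⟩
  have hw := hv.sub (isDerivTower_eval N (Set.Ioi 0) p)
  have key : ∀ i ≤ N, ∀ x, 0 < x → v (N - i) x - (derivative^[N - i] p).eval x = 0 := by
    intro i
    induction i with
    | zero =>
      intro _ x hx
      rw [Nat.sub_zero, hN x hx, iterate_derivative_eq_zero_of_degree_lt hp]
      simp
    | succ i ih =>
      intro hi x hx
      have hd : ∀ y ∈ Set.Ioi (0 : ℝ), HasDerivAt
          (fun x => v (N - (i + 1)) x - (derivative^[N - (i + 1)] p).eval x) 0 y := by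
        intro y hy
        have h := hw (N - (i + 1)) (by omega) y hy
        have e : N - (i + 1) + 1 = N - i := by omega
        simp only [e, ih (by omega) y hy] at h
        exact h
      have h := isOpen_Ioi.is_const_of_deriv_eq_zero isPreconnected_Ioi
        (fun y hy => (hd y hy).differentiableAt.differentiableWithinAt)
        (fun y hy => (hd y hy).deriv) (Set.mem_Ioi.2 hx) (Set.mem_Ioi.2 one_pos)
      rw [h, hp1 _ (by omega), sub_self]
  intro x hx
  have := key N le_rfl x hx
  simp only [Nat.sub_self, Function.iterate_zero, id] at this
  linarith

/-! ### Interpolation error with a polynomial main term -/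

/-- The error of Hermite interpolation, with an arbitrary polynomial main term. -/
theorem exists_hermite_error {a b : ℝ} (hab : a < b) {k l : ℕ} {v : ℕ → ℝ → ℝ}
    (hv : IsDerivTower (k + l) (Set.Icc a b) v) {P : ℝ[X]} (hP : P.degree < (k + l : ℕ))
    (hPa : ∀ j < k, (derivative^[j] P).eval a = v j a)
    (hPb : ∀ j < l, (derivative^[j] P).eval b = v j b) (r : ℝ[X]) {x : ℝ}
    (hx : x ∈ Set.Ioo a b) :
    ∃ ξ ∈ Set.Ioo a b, v 0 x - P.eval x = (x - a) ^ k * (x - b) ^ l *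
      (r.eval x + (v (k + l) ξ -
        (derivative^[k + l] ((X - C a) ^ k * (X - C b) ^ l * r)).eval ξ) / (k + l).factorial) := by
  set w : ℝ[X] := (X - C a) ^ k * (X - C b) ^ l with hw
  have hwx : w.eval x = (x - a) ^ k * (x - b) ^ l := by simp [hw]
  have hwx0 : w.eval x ≠ 0 := by
    rw [hwx]
    exact mul_ne_zero (pow_ne_zero _ (sub_ne_zero.2 hx.1.ne'))
      (pow_ne_zero _ (sub_ne_zero.2 hx.2.ne))
  -- With this `K`, the function v - P - w(r + K) gains a zero at `x`, giving k+l+1 zeros in all.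
  set K : ℝ := (v 0 x - P.eval x) / w.eval x - r.eval x with hK
  have hKx : w.eval x * (r.eval x + K) = v 0 x - P.eval x := by
    rw [hK]; field_simp; ring
  have hwm : w.Monic := ((monic_X_sub_C a).pow k).mul ((monic_X_sub_C b).pow l)
  have hwd : w.natDegree = k + l :=
    natDegree_eq_of_degree_eq_some (degree_X_sub_C_pow_mul_X_sub_C_pow a b k l)
  have hwder : derivative^[k + l] w = C ((k + l).factorial : ℝ) := by
    have h0 : (derivative^[k + l] w).natDegree = 0 := by
      have := natDegree_iterate_derivative w (k + l)
      omega
    rw [eq_C_of_natDegree_eq_zero h0, coeff_iterate_derivative, zero_add, ← hwd,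
      hwm.coeff_natDegree, Nat.descFactorial_self]
    simp
  obtain ⟨ξ, hξ, h0⟩ := exists_deriv_eq_zero_of_multiple_zeros hab (k + l) _ k l {x}
    (hv.sub (isDerivTower_eval (k + l) _ (P + w * (r + C K))))
    (fun j hj => by
      rw [iterate_map_add, eval_add, hPa j hj, hw, mul_assoc,
        eval_iterate_derivative_X_sub_C_pow_mul_of_lt _ _ hj]
      ring)
    (fun j hj => by
      rw [iterate_map_add, eval_add, hPb j hj, hw, mul_comm (_ ^ k), mul_assoc,
        eval_iterate_derivative_X_sub_C_pow_mul_of_lt _ _ hj]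
      ring)
    (fun y hy => by
      rw [Finset.mem_singleton.1 hy]
      refine ⟨hx, ?_⟩
      simp only [Function.iterate_zero, id, eval_add, eval_mul, eval_C]
      linarith)
    (Finset.singleton_nonempty x) (by simp)
  refine ⟨ξ, hξ, ?_⟩
  have hf : ((k + l).factorial : ℝ) ≠ 0 := by positivity
  rw [mul_add, iterate_map_add, iterate_map_add,
    iterate_derivative_eq_zero_of_degree_lt hP, mul_comm w (C K), iterate_derivative_C_mul, hwder]
    at h0
  simp only [eval_add, eval_zero, eval_mul, eval_C] at h0
  rw [← hKx, hwx]
  congr 2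
  rw [eq_div_iff hf]
  linarith

/-- The extra root a - l(b-a) makes all roots sum to (k+l+1)a, which puts the zero of the linear
derivative at a. -/
theorem iterate_derivative_hermite_node_mul_linear (a b : ℝ) (k l : ℕ) :
    derivative^[k + l] ((X - C a) ^ k * (X - C b) ^ l * (X - C (a - l * (b - a)))) =
      C ((k + l + 1).factorial : ℝ) * (X - C a) := by
  set w : ℝ[X] := (X - C a) ^ k * (X - C b) ^ l * (X - C (a - l * (b - a))) with hw
  have hm1 := (monic_X_sub_C a).pow k
  have hm2 := (monic_X_sub_C b).pow l
  have hm3 := monic_X_sub_C (a - l * (b - a))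
  have hwm : w.Monic := (hm1.mul hm2).mul hm3
  have hwd : w.natDegree = k + l + 1 := by
    rw [(hm1.mul hm2).natDegree_mul hm3, natDegree_X_sub_C,
      natDegree_eq_of_degree_eq_some (degree_X_sub_C_pow_mul_X_sub_C_pow a b k l)]
  have hnext : w.coeff (k + l) = -((k + l + 1) * a) := by
    have h := (hm1.mul hm2).nextCoeff_mul hm3
    rw [hm1.nextCoeff_mul hm2, (monic_X_sub_C a).nextCoeff_pow, (monic_X_sub_C b).nextCoeff_pow,
      nextCoeff_X_sub_C, nextCoeff_X_sub_C, nextCoeff_X_sub_C, ← hw,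
      nextCoeff_of_natDegree_pos (by omega), hwd, Nat.add_sub_cancel] at h
    rw [h]
    simp only [nsmul_eq_mul]
    ring
  have hlead : w.coeff (k + l + 1) = 1 := by rw [← hwd]; exact hwm.coeff_natDegree
  ext m
  rw [coeff_iterate_derivative, coeff_C_mul, coeff_sub]
  rcases m with _ | _ | m
  · rw [zero_add, hnext, Nat.descFactorial_self, Nat.factorial_succ]
    simp only [nsmul_eq_mul, coeff_X_zero, coeff_C_zero]
    push_cast
    ring
  · have e : 0 + 1 + (k + l) = k + l + 1 := by ring
    rw [e, hlead]
    have : (k + l + 1).descFactorial (k + l) = (k + l + 1).factorial := by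
      have h := Nat.factorial_mul_descFactorial (show k + l ≤ k + l + 1 by omega)
      simpa using h
    rw [this]
    simp [coeff_X]
  · rw [coeff_eq_zero_of_natDegree_lt (by omega)]
    simp [coeff_X]

/-! ### Asymptotics of the mean as b → a⁺ -/

open Filter Topology Asymptotics in
/-- The leading-order comparison behind the expansion of the mean as `b → a`. -/
theorem coeff_eq_zero_of_mean_equations {F R : ℝ → ℝ} {a B p q : ℝ} {d : ℕ}
    (hF : ContinuousAt F a) (hFa : F a ≠ 0) (hR : R =o[𝓝 a] fun y => y - a) (hpq : p ≠ q)
    (h : ∀ b, a < b → ∃ x ξ η ξ' η', x ∈ Set.Ioo a b ∧ ξ ∈ Set.Ioo a b ∧ η ∈ Set.Ioo a b ∧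
      ξ' ∈ Set.Ioo a b ∧ η' ∈ Set.Ioo a b ∧ (x - a) ^ d * F ξ = (b - x) ^ d * F η ∧
      (x - a) ^ d * (B * (x - a + p * (b - a)) + R ξ') =
        (b - x) ^ d * (B * (x - a + q * (b - a)) + R η')) : B = 0 := by
  choose! x ξ η ξ' η' hx hξ hη hξ' hη' h1 h2 using h
  set l := 𝓝[>] a
  have hl : ∀ᶠ b in l, a < b := self_mem_nhdsWithin
  set T : ℝ → ℝ := fun b => (x b - a) / (b - a)
  have hT : ∀ᶠ b in l, 0 < T b ∧ T b < 1 := hl.mono fun b hb =>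
    ⟨div_pos (sub_pos.2 (hx b hb).1) (sub_pos.2 hb),
      (div_lt_one (sub_pos.2 hb)).2 (sub_lt_sub_right (hx b hb).2 a)⟩
  have hxT : ∀ b, a < b → x b - a = T b * (b - a) ∧ b - x b = (1 - T b) * (b - a) := by
    intro b hb
    have : b - a ≠ 0 := (sub_pos.2 hb).ne'
    have e : x b - a = T b * (b - a) := (div_mul_cancel₀ _ this).symm
    exact ⟨e, by linarith⟩
  have hlim : ∀ z : ℝ → ℝ, (∀ b, a < b → z b ∈ Set.Ioo a b) → Tendsto z l (𝓝 a) := fun z hz =>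
    tendsto_of_tendsto_of_tendsto_of_le_of_le' tendsto_const_nhds
      (tendsto_id.mono_left nhdsWithin_le_nhds) (hl.mono fun b hb => (hz b hb).1.le)
      (hl.mono fun b hb => (hz b hb).2.le)
  have hRlim : ∀ z : ℝ → ℝ, (∀ b, a < b → z b ∈ Set.Ioo a b) →
      Tendsto (fun b => R (z b) / (b - a)) l (𝓝 0) := fun z hz => by
    refine ((hR.comp_tendsto (hlim z hz)).trans_isBigO ?_).tendsto_div_nhds_zero
    refine IsBigO.of_bound 1 (hl.mono fun b hb => ?_)
    have := hz b hb
    simp only [Function.comp, Real.norm_eq_abs, one_mul]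
    rw [abs_of_pos (sub_pos.2 this.1), abs_of_pos (sub_pos.2 hb)]
    linarith [this.2]
  have hFlim : ∀ z : ℝ → ℝ, (∀ b, a < b → z b ∈ Set.Ioo a b) →
      Tendsto (fun b => F (z b) - F a) l (𝓝 0) := fun z hz => by
    simpa using (hF.tendsto.comp (hlim z hz)).sub_const (F a)
  have hTd : ∀ᶠ b in l, |T b ^ d| ≤ 1 := hT.mono fun b hb => by
    rw [abs_of_nonneg (pow_nonneg hb.1.le d)]
    exact pow_le_one₀ hb.1.le hb.2.le
  have hTd' : ∀ᶠ b in l, |(1 - T b) ^ d| ≤ 1 := hT.mono fun b hb => by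
    rw [abs_of_nonneg (pow_nonneg (sub_nonneg.2 hb.2.le) d)]
    exact pow_le_one₀ (sub_nonneg.2 hb.2.le) (by linarith)
  -- The difference equals ((1-T)^d (F η - F a) - T^d (F ξ - F a)) / F a.
  have hδ : Tendsto (fun b => T b ^ d - (1 - T b) ^ d) l (𝓝 0) := by
    have := ((bdd_le_mul_tendsto_zero' 1 hTd' (hFlim η hη)).sub
      (bdd_le_mul_tendsto_zero' 1 hTd (hFlim ξ hξ))).div_const (F a)
    rw [sub_zero, zero_div] at this
    refine this.congr' (hl.mono fun b hb => ?_)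
    have e := h1 b hb
    rw [(hxT b hb).1, (hxT b hb).2, mul_pow, mul_pow] at e
    have hp : (b - a) ^ d ≠ 0 := pow_ne_zero _ (sub_pos.2 hb).ne'
    have e' : T b ^ d * F (ξ b) = (1 - T b) ^ d * F (η b) := by
      apply mul_left_cancel₀ hp
      linarith
    rw [div_eq_iff hFa]
    linarith
  by_contra hB
  -- Split T^d B(T+p) - (1-T)^d B(T+q) as B(T+q)(T^d - (1-T)^d) + B(p-q)T^d; every term except the
  -- last is known to tend to 0.
  have hBT : Tendsto (fun b => T b ^ d) l (𝓝 0) := by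
    have hTq : ∀ᶠ b in l, |B * (T b + q)| ≤ |B| * (1 + |q|) := hT.mono fun b hb => by
      rw [abs_mul]
      gcongr
      refine (abs_add_le _ _).trans ?_
      rw [abs_of_pos hb.1]
      linarith [hb.2]
    have := (((bdd_le_mul_tendsto_zero' 1 hTd' (hRlim η' hη')).sub
      (bdd_le_mul_tendsto_zero' 1 hTd (hRlim ξ' hξ'))).sub
      (bdd_le_mul_tendsto_zero' _ hTq hδ)).div_const (B * (p - q))
    rw [sub_zero, sub_zero, zero_div] at this
    refine this.congr' (hl.mono fun b hb => ?_)
    have e := h2 b hb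
    have hba : b - a ≠ 0 := (sub_pos.2 hb).ne'
    have hp : (b - a) ^ d * (b - a) ≠ 0 := mul_ne_zero (pow_ne_zero _ hba) hba
    rw [(hxT b hb).1, (hxT b hb).2, mul_pow, mul_pow] at e
    have r1 : R (ξ' b) = R (ξ' b) / (b - a) * (b - a) := (div_mul_cancel₀ _ hba).symm
    have r2 : R (η' b) = R (η' b) / (b - a) * (b - a) := (div_mul_cancel₀ _ hba).symm
    rw [r1, r2] at e
    have e' : T b ^ d * (B * (T b + p) + R (ξ' b) / (b - a)) =
        (1 - T b) ^ d * (B * (T b + q) + R (η' b) / (b - a)) := by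
      apply mul_left_cancel₀ hp
      linear_combination e
    rw [div_eq_iff (mul_ne_zero hB (sub_ne_zero.2 hpq))]
    linear_combination -e'
  have hsum : Tendsto (fun b => T b ^ d + (1 - T b) ^ d) l (𝓝 0) := by
    have := (hBT.add hBT).sub hδ
    simp only [add_zero, sub_zero] at this
    exact this.congr fun b => by ring
  -- One of T and 1-T is at least 1/2.
  have hge : ((1 : ℝ) / 2) ^ d ≤ 0 := by
    refine ge_of_tendsto hsum (hT.mono fun b hb => ?_)
    have p1 := pow_nonneg hb.1.le d
    have p2 := pow_nonneg (sub_nonneg.2 hb.2.le) d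
    rcases le_total (1 / 2) (T b) with h | h
    · have := pow_le_pow_left₀ (by norm_num) h d
      linarith
    · have := pow_le_pow_left₀ (by norm_num) (show (1 : ℝ) / 2 ≤ 1 - T b by linarith) d
      linarith
  exact absurd hge (not_le.2 (by positivity))

/-! ### The reduced mean equation -/

theorem exists_hermite_error_of_natDegree_le {a b : ℝ} (hab : a < b) {k l N : ℕ}
    (hN : N = k + l + 2) {v : ℕ → ℝ → ℝ} (hv : IsDerivTower N (Set.Icc a b) v) {P : ℝ[X]}
    (hP : P.natDegree ≤ k + l + 1) (hPa : ∀ j ≤ k, (derivative^[j] P).eval a = v j a)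
    (hPb : ∀ j ≤ l, (derivative^[j] P).eval b = v j b) (B : ℝ) {x : ℝ} (hx : x ∈ Set.Ioo a b) :
    ∃ ξ ∈ Set.Ioo a b, v 0 x - P.eval x = (x - a) ^ (k + 1) * (x - b) ^ (l + 1) *
      (B * (x - a + (l + 1) * (b - a)) +
        (v N ξ - B * (N + 1).factorial * (ξ - a)) / N.factorial) := by
  have hN' : N = k + 1 + (l + 1) := by omega
  subst hN'
  obtain ⟨ξ, hξ, h⟩ := exists_hermite_error hab hv
    (degree_le_natDegree.trans_lt (by exact_mod_cast (by omega : P.natDegree < k + 1 + (l + 1))))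
    (fun j hj => hPa j (Nat.lt_succ_iff.1 hj)) (fun j hj => hPb j (Nat.lt_succ_iff.1 hj))
    (C B * (X - C (a - ((l + 1 : ℕ) : ℝ) * (b - a)))) hx
  refine ⟨ξ, hξ, ?_⟩
  rw [mul_left_comm, iterate_derivative_C_mul, iterate_derivative_hermite_node_mul_linear] at h
  rw [h]
  simp only [eval_mul, eval_C, eval_sub, eval_X]
  push_cast
  ring

theorem mean_factor {a b x α β : ℝ} {m₁ m₂ : ℕ} (hm : m₂ < m₁) :
    (x - a) ^ (m₁ + 1) * (x - b) ^ (m₂ + 1) * α -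
        (-1) ^ (m₁ - m₂) * ((x - a) ^ (m₂ + 1) * (x - b) ^ (m₁ + 1) * β) =
      (x - a) ^ (m₂ + 1) * (x - b) ^ (m₂ + 1) *
        ((x - a) ^ (m₁ - m₂) * α - (b - x) ^ (m₁ - m₂) * β) := by
  obtain ⟨d, rfl⟩ := Nat.exists_eq_add_of_lt hm
  have e : m₂ + d + 1 - m₂ = d + 1 := by omega
  have h : (b - x) ^ (d + 1) = (-1) ^ (d + 1) * (x - b) ^ (d + 1) := by
    rw [← mul_pow]; ring
  rw [e, h]
  ring

/-- The mean equation, cleared of the factors it always contains. -/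
theorem exists_reduced_mean_equation {a b : ℝ} (hab : a < b) {m₁ m₂ N : ℕ} (hm : m₂ < m₁)
    (hN : N = m₁ + m₂ + 2) {v : ℕ → ℝ → ℝ} (hv : IsDerivTower N (Set.Icc a b) v) {P Q : ℝ[X]}
    (hP : P.natDegree ≤ m₁ + m₂ + 1) (hPa : ∀ j ≤ m₁, (derivative^[j] P).eval a = v j a)
    (hPb : ∀ j ≤ m₂, (derivative^[j] P).eval b = v j b)
    (hQ : Q.natDegree ≤ m₂ + m₁ + 1) (hQa : ∀ j ≤ m₂, (derivative^[j] Q).eval a = v j a)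
    (hQb : ∀ j ≤ m₁, (derivative^[j] Q).eval b = v j b) {x : ℝ} (hx : x ∈ Set.Ioo a b)
    (h : v 0 x - P.eval x = (-1) ^ (m₁ - m₂) * (v 0 x - Q.eval x)) (B : ℝ) :
    ∃ ξ ∈ Set.Ioo a b, ∃ η ∈ Set.Ioo a b,
      (x - a) ^ (m₁ - m₂) * (B * (x - a + (m₂ + 1) * (b - a)) +
          (v N ξ - B * (N + 1).factorial * (ξ - a)) / N.factorial) =
        (b - x) ^ (m₁ - m₂) * (B * (x - a + (m₁ + 1) * (b - a)) +
          (v N η - B * (N + 1).factorial * (η - a)) / N.factorial) := by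
  obtain ⟨ξ, hξ, h1⟩ := exists_hermite_error_of_natDegree_le hab hN hv hP hPa hPb B hx
  obtain ⟨η, hη, h2⟩ := exists_hermite_error_of_natDegree_le hab (by omega) hv hQ hQa hQb B hx
  refine ⟨ξ, hξ, η, hη, ?_⟩
  rw [h1, h2, ← sub_eq_zero, mean_factor hm] at h
  have hne : (x - a) ^ (m₂ + 1) * (x - b) ^ (m₂ + 1) ≠ 0 :=
    mul_ne_zero (pow_ne_zero _ (sub_ne_zero.2 hx.1.ne')) (pow_ne_zero _ (sub_ne_zero.2 hx.2.ne))
  exact sub_eq_zero.1 ((mul_eq_zero.1 h).resolve_left hne)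

/-! ### Existence of mean points -/

theorem exists_isHermiteInterpolant (f : ℝ → ℝ) (k l : ℕ) {a b : ℝ} (hab : a ≠ b) :
    ∃ P, IsHermiteInterpolant f k l a b P := by
  obtain ⟨P, h1, h2, h3⟩ := exists_hermite_polynomial hab (fun j => iteratedDeriv j f a)
    (fun j => iteratedDeriv j f b) (k + 1) (l + 1)
  refine ⟨P, ?_, fun j hj => h2 j (by omega), fun j hj => h3 j (by omega)⟩
  exact natDegree_le_iff_coeff_eq_zero.2 fun m hm =>
    (degree_lt_iff_coeff_zero _ _).1 h1 m (by omega)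

-- The reduced equation compares (x-a)^d α with (b-x)^d β, where α and β stay within positive bounds
-- after a sign normalisation. The second term wins near a and the first near b, so the intermediate
-- value theorem applies.
open Filter Topology in
theorem exists_isMeanPoint {f : ℝ → ℝ} {m₁ m₂ N : ℕ} {a b : ℝ} (hab : a < b) (hm : m₂ < m₁)
    (hN : N = m₁ + m₂ + 2) (hv : IsDerivTower N (Set.Icc a b) fun j => iteratedDeriv j f)
    (hc : ContinuousOn (iteratedDeriv N f) (Set.Icc a b))
    (h0 : ∀ x ∈ Set.Icc a b, iteratedDeriv N f x ≠ 0) : ∃ x, IsMeanPoint f m₁ m₂ a b x := by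
  obtain ⟨P, hP⟩ := exists_isHermiteInterpolant f m₁ m₂ hab.ne
  obtain ⟨Q, hQ⟩ := exists_isHermiteInterpolant f m₂ m₁ hab.ne
  set d := m₁ - m₂ with hd
  have hd0 : d ≠ 0 := by omega
  set F : ℝ → ℝ := iteratedDeriv N f
  obtain ⟨σ, hσ⟩ : ∃ σ : ℝ, ∀ x ∈ Set.Icc a b, 0 < σ * F x := by
    have haI : a ∈ Set.Icc a b := Set.left_mem_Icc.2 hab.le
    refine ⟨F a, fun x hx => ?_⟩
    by_contra! hneg
    have hz : (0 : ℝ) ∈ Set.Icc (F a * F x) (F a * F a) := ⟨hneg, mul_self_nonneg _⟩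
    obtain ⟨y, hy, hy0⟩ := isPreconnected_Icc.intermediate_value hx haI
      (continuousOn_const.mul hc) hz
    rcases mul_eq_zero.1 hy0 with h | h
    · exact h0 a haI h
    · exact h0 y hy h
  obtain ⟨x₀, hx₀, hmin⟩ := isCompact_Icc.exists_isMinOn (Set.nonempty_Icc.2 hab.le)
    (continuousOn_const (c := σ).mul hc)
  obtain ⟨x₁, -, hmax⟩ := isCompact_Icc.exists_isMaxOn (Set.nonempty_Icc.2 hab.le)
    (continuousOn_const (c := σ).mul hc)
  set μ := σ * F x₀
  set M := σ * F x₁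
  have hμ : 0 < μ := hσ x₀ hx₀
  set D : ℝ → ℝ := fun x => (f x - P.eval x) - (-1) ^ d * (f x - Q.eval x) with hD
  set w : ℝ → ℝ := fun x => (x - a) ^ (m₂ + 1) * (x - b) ^ (m₂ + 1)
  have hw0 : ∀ x ∈ Set.Ioo a b, w x ≠ 0 := fun x hx =>
    mul_ne_zero (pow_ne_zero _ (sub_ne_zero.2 hx.1.ne')) (pow_ne_zero _ (sub_ne_zero.2 hx.2.ne))
  have hNpos : 0 < N := by omega
  have hNf : (0 : ℝ) < N.factorial := by positivity
  -- Dividing by `w` removes the endpoint zeros of `D`, which would hide its change of sign.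
  set G : ℝ → ℝ := fun x => σ * N.factorial * (D x / w x) with hG
  have key : ∀ x ∈ Set.Ioo a b, ∃ α ∈ Set.Icc μ M, ∃ β ∈ Set.Icc μ M,
      G x = (x - a) ^ d * α - (b - x) ^ d * β := by
    intro x hx
    obtain ⟨ξ, hξ, h1⟩ := exists_hermite_error_of_natDegree_le hab hN hv hP.1 hP.2.1 hP.2.2 0 hx
    obtain ⟨η, hη, h2⟩ := exists_hermite_error_of_natDegree_le hab (by omega) hv hQ.1 hQ.2.1
      hQ.2.2 0 hx
    have hξ' := Set.Ioo_subset_Icc_self hξ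
    have hη' := Set.Ioo_subset_Icc_self hη
    refine ⟨σ * F ξ, ⟨hmin hξ', hmax hξ'⟩, σ * F η, ⟨hmin hη', hmax hη'⟩, ?_⟩
    simp only [iteratedDeriv_zero, zero_mul, zero_add, sub_zero] at h1 h2
    have : D x = w x * ((x - a) ^ d * (F ξ / N.factorial) - (b - x) ^ d * (F η / N.factorial)) := by
      rw [hD]
      simp only
      rw [h1, h2, hd, mean_factor hm]
    rw [hG]
    simp only
    rw [this, mul_div_cancel_left₀ _ (hw0 x hx)]
    field_simp
  have hGc : ContinuousOn G (Set.Ioo a b) := by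
    have hfc : ContinuousOn f (Set.Ioo a b) := fun x hx => by
      have h := (hv 0 hNpos x (Set.Ioo_subset_Icc_self hx)).continuousAt
      simp only [iteratedDeriv_zero] at h
      exact h.continuousWithinAt
    refine continuousOn_const.mul (ContinuousOn.div ?_ (by fun_prop) hw0)
    exact (hfc.sub P.continuous.continuousOn).sub
      (continuousOn_const.mul (hfc.sub Q.continuous.continuousOn))
  have hneg : ∃ x ∈ Set.Ioo a b, G x < 0 := by
    have hlim : ContinuousAt (fun x => (x - a) ^ d * M - (b - x) ^ d * μ) a := by fun_prop
    have hlt : (a - a) ^ d * M - (b - a) ^ d * μ < 0 := by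
      have := mul_pos (pow_pos (sub_pos.2 hab) d) hμ
      rw [sub_self, zero_pow hd0]
      linarith
    have hev : ∀ᶠ x in 𝓝[>] a, (x - a) ^ d * M - (b - x) ^ d * μ < 0 ∧ x ∈ Set.Ioo a b :=
      ((hlim.eventually_lt_const hlt).filter_mono nhdsWithin_le_nhds).and
        (Ioo_mem_nhdsGT hab)
    obtain ⟨x, hx, hxI⟩ := hev.exists
    obtain ⟨α, hα, β, hβ, e⟩ := key x hxI
    refine ⟨x, hxI, ?_⟩
    have p1 := mul_le_mul_of_nonneg_left hα.2 (pow_nonneg (sub_nonneg.2 hxI.1.le) d)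
    have p2 := mul_le_mul_of_nonneg_left hβ.1 (pow_nonneg (sub_nonneg.2 hxI.2.le) d)
    linarith
  have hpos : ∃ x ∈ Set.Ioo a b, 0 < G x := by
    have hlim : ContinuousAt (fun x => (x - a) ^ d * μ - (b - x) ^ d * M) b := by fun_prop
    have hlt : 0 < (b - a) ^ d * μ - (b - b) ^ d * M := by
      have := mul_pos (pow_pos (sub_pos.2 hab) d) hμ
      rw [sub_self, zero_pow hd0]
      linarith
    have hev : ∀ᶠ x in 𝓝[<] b, 0 < (x - a) ^ d * μ - (b - x) ^ d * M ∧ x ∈ Set.Ioo a b :=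
      ((hlim.eventually_const_lt hlt).filter_mono nhdsWithin_le_nhds).and
        (Ioo_mem_nhdsLT hab)
    obtain ⟨x, hx, hxI⟩ := hev.exists
    obtain ⟨α, hα, β, hβ, e⟩ := key x hxI
    refine ⟨x, hxI, ?_⟩
    have p1 := mul_le_mul_of_nonneg_left hα.1 (pow_nonneg (sub_nonneg.2 hxI.1.le) d)
    have p2 := mul_le_mul_of_nonneg_left hβ.2 (pow_nonneg (sub_nonneg.2 hxI.2.le) d)
    linarith
  obtain ⟨y, hy, hy'⟩ := hneg
  obtain ⟨z, hz, hz'⟩ := hpos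
  obtain ⟨x, hx, hx0⟩ := isPreconnected_Ioo.intermediate_value hy hz hGc ⟨hy'.le, hz'.le⟩
  have hσ0 : σ ≠ 0 := fun h => by simp [μ, h] at hμ
  refine ⟨x, by rw [min_eq_left hab.le]; exact hx.1, by rw [max_eq_right hab.le]; exact hx.2,
    P, Q, hP, hQ, sub_eq_zero.1 ?_⟩
  have h := (mul_eq_zero.1 hx0).resolve_left (mul_ne_zero hσ0 hNf.ne')
  exact (div_eq_zero_iff.1 h).resolve_right (hw0 x hx)

/-! ### Consequences of common mean points, and invariance -/

/-- If `f` and `g` share a mean point on every interval to the right of `a`, then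
the logarithmic derivatives of their derivatives of order `m₁ + m₂ + 2` agree at `a`. -/
theorem deriv_proportional_of_common_mean_points {f g : ℝ → ℝ} {m₁ m₂ N : ℕ} {a : ℝ} (ha : 0 < a)
    (hm : m₂ < m₁) (hN : N = m₁ + m₂ + 2)
    (hf : IsDerivTower (N + 1) (Set.Ioi 0) fun j => iteratedDeriv j f)
    (hg : IsDerivTower (N + 1) (Set.Ioi 0) fun j => iteratedDeriv j g)
    (hf0 : iteratedDeriv N f a ≠ 0)
    (h : ∀ b, a < b → ∃ x, IsMeanPoint f m₁ m₂ a b x ∧ IsMeanPoint g m₁ m₂ a b x) :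
    iteratedDeriv (N + 1) g a =
      iteratedDeriv N g a / iteratedDeriv N f a * iteratedDeriv (N + 1) f a := by
  set c := iteratedDeriv N g a / iteratedDeriv N f a with hc
  set v : ℕ → ℝ → ℝ := fun j x => iteratedDeriv j g x - c * iteratedDeriv j f x with hv_def
  have hv : IsDerivTower (N + 1) (Set.Ioi 0) v := hg.sub (hf.const_mul c)
  have hva : v N a = 0 := by simp only [hv_def, hc]; field_simp; ring
  have hN1 : (0 : ℝ) < (N + 1).factorial := by positivity
  set B : ℝ := v (N + 1) a / (N + 1).factorial with hB
  have hBv : B * (N + 1).factorial = v (N + 1) a := div_mul_cancel₀ _ hN1.ne'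
  have hder := hv N N.lt_succ_self a ha
  suffices B = 0 by
    have h0 : v (N + 1) a = 0 := by rw [← hBv, this, zero_mul]
    simp only [hv_def] at h0
    linarith
  refine coeff_eq_zero_of_mean_equations (F := fun y => iteratedDeriv N f y / N.factorial)
    (R := fun y => (v N y - B * (N + 1).factorial * (y - a)) / N.factorial) (a := a)
    (p := m₂ + 1) (q := m₁ + 1) (d := m₁ - m₂)
    ((hf N N.lt_succ_self a ha).continuousAt.div_const _) (by positivity) ?_
    (by have : (m₂ : ℝ) < m₁ := by exact_mod_cast hm
        linarith) ?_
  · have := hder.isLittleO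
    simp only [hva, sub_zero, smul_eq_mul] at this
    refine (this.const_mul_left ((N.factorial : ℝ)⁻¹)).congr_left fun y => ?_
    rw [hBv, div_eq_inv_mul]
    ring
  · intro b hab
    obtain ⟨x, hxf, hxg⟩ := h b hab
    obtain ⟨hx1, hx2, P, Q, hP, hQ, hPQ⟩ := hxf
    obtain ⟨-, -, P', Q', hP', hQ', hPQ'⟩ := hxg
    rw [min_eq_left hab.le] at hx1
    rw [max_eq_right hab.le] at hx2
    have hsub : Set.Icc a b ⊆ Set.Ioi 0 := fun y hy => ha.trans_le hy.1
    have hdeg : ∀ {p q : ℝ[X]} {n : ℕ}, p.natDegree ≤ n → q.natDegree ≤ n →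
        (p - C c * q).natDegree ≤ n := fun h1 h2 =>
      (natDegree_sub_le _ _).trans (max_le h1 ((natDegree_C_mul_le _ _).trans h2))
    have hev : ∀ {p q : ℝ[X]} {j : ℕ} {y : ℝ}, (derivative^[j] p).eval y = iteratedDeriv j g y →
        (derivative^[j] q).eval y = iteratedDeriv j f y →
        (derivative^[j] (p - C c * q)).eval y = v j y := fun h1 h2 => by
      rw [iterate_derivative_sub, iterate_derivative_C_mul, eval_sub, eval_C_mul, h1, h2]
    -- For `f` the leading order suffices, so the main term is 0; for `v` the main term has slope
    -- `B`.
    obtain ⟨ξ, hξ, η, hη, e1⟩ := exists_reduced_mean_equation hab hm hN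
      ((hf.of_le N.le_succ).mono hsub) hP.1 hP.2.1 hP.2.2 hQ.1 hQ.2.1 hQ.2.2 ⟨hx1, hx2⟩
      (by simpa using hPQ) 0
    obtain ⟨ξ', hξ', η', hη', e2⟩ := exists_reduced_mean_equation hab hm hN
      ((hv.of_le N.le_succ).mono hsub) (hdeg hP'.1 hP.1)
      (fun j hj => hev (hP'.2.1 j hj) (hP.2.1 j hj))
      (fun j hj => hev (hP'.2.2 j hj) (hP.2.2 j hj)) (hdeg hQ'.1 hQ.1)
      (fun j hj => hev (hQ'.2.1 j hj) (hQ.2.1 j hj))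
      (fun j hj => hev (hQ'.2.2 j hj) (hQ.2.2 j hj)) ⟨hx1, hx2⟩
      (by simp only [hv_def, iteratedDeriv_zero, eval_sub, eval_mul, eval_C]
          linear_combination hPQ' - c * hPQ) B
    exact ⟨x, ξ, η, ξ', η', ⟨hx1, hx2⟩, hξ, hη, hξ', hη', by simpa using e1, e2⟩

theorem iteratedDeriv_eq_of_eq_const_mul_add {f g : ℝ → ℝ} {N : ℕ} {c : ℝ} {p : ℝ[X]}
    (hf : IsDerivTower N (Set.Ioi 0) fun j => iteratedDeriv j f)
    (h : ∀ x, 0 < x → g x = c * f x + p.eval x) :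
    ∀ j ≤ N, ∀ x, 0 < x →
      iteratedDeriv j g x = c * iteratedDeriv j f x + (derivative^[j] p).eval x := by
  intro j
  induction j with
  | zero => simpa using h
  | succ j ih =>
    intro hj x hx
    have h1 := ((hf.const_mul c).add (isDerivTower_eval N _ p)) j hj x hx
    rw [iteratedDeriv_succ]
    refine (h1.congr_of_eventuallyEq ?_).deriv
    filter_upwards [isOpen_Ioi.mem_nhds hx] with y hy using ih (by omega) y hy

theorem IsMeanPoint.const_mul_add {f g : ℝ → ℝ} {m₁ m₂ N : ℕ} {c : ℝ} {p : ℝ[X]} {a b x : ℝ}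
    (hx : IsMeanPoint f m₁ m₂ a b x) (hN : N = m₁ + m₂ + 2) (ha : 0 < a) (hb : 0 < b)
    (hf : IsDerivTower N (Set.Ioi 0) fun j => iteratedDeriv j f)
    (hp : p.natDegree ≤ m₁ + m₂ + 1) (h : ∀ x, 0 < x → g x = c * f x + p.eval x) :
    IsMeanPoint g m₁ m₂ a b x := by
  have hder := iteratedDeriv_eq_of_eq_const_mul_add hf h
  -- Since `p` has degree at most m₁+m₂+1, it is its own interpolant.
  have key : ∀ {k l : ℕ} {P : ℝ[X]}, k + l = m₁ + m₂ → IsHermiteInterpolant f k l a b P →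
      IsHermiteInterpolant g k l a b (C c * P + p) := by
    intro k l P hkl hP
    refine ⟨natDegree_add_le_of_degree_le ((natDegree_C_mul_le _ _).trans hP.1) (by omega),
      fun j hj => ?_, fun j hj => ?_⟩
    · rw [hder j (by omega) a ha, ← hP.2.1 j hj, iterate_map_add, iterate_derivative_C_mul,
        eval_add, eval_C_mul]
    · rw [hder j (by omega) b hb, ← hP.2.2 j hj, iterate_map_add, iterate_derivative_C_mul,
        eval_add, eval_C_mul]
  obtain ⟨h1, h2, P, Q, hP, hQ, hPQ⟩ := hx
  refine ⟨h1, h2, _, _, key rfl hP, key (add_comm _ _) hQ, ?_⟩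
  rw [h x ((lt_min ha hb).trans h1), eval_add, eval_add, eval_C_mul, eval_C_mul]
  linear_combination c * hPQ

end HermiteMeans

/-! ### The equivalence -/

theorem theorem8 (m₁ m₂ n : ℕ) (hm : m₂ < m₁) (hn : n = m₁ + m₂ + 1) (f g : ℝ → ℝ)
    (hf : ContDiffOn ℝ ((n + 2 : ℕ) : WithTop ℕ∞) f (Set.Ioi 0))
    (hg : ContDiffOn ℝ ((n + 2 : ℕ) : WithTop ℕ∞) g (Set.Ioi 0))
    (hf0 : ∀ x : ℝ, 0 < x → iteratedDeriv (n + 1) f x ≠ 0)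
    (hg0 : ∀ x : ℝ, 0 < x → iteratedDeriv (n + 1) g x ≠ 0) :
    (∀ a b : ℝ, 0 < a → 0 < b →
        HermiteMeans.hermiteMean f m₁ m₂ a b = HermiteMeans.hermiteMean g m₁ m₂ a b) ↔
      ∃ (c : ℝ) (p : Polynomial ℝ), p.natDegree ≤ n ∧
        ∀ x : ℝ, 0 < x → g x = c * f x + p.eval x := by
  have hF := HermiteMeans.isDerivTower_iteratedDeriv isOpen_Ioi hf
  have hG := HermiteMeans.isDerivTower_iteratedDeriv isOpen_Ioi hg
  have hN : n + 1 = m₁ + m₂ + 2 := by omega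
  constructor
  · intro h
    have hex : ∀ {φ : ℝ → ℝ} {a b : ℝ},
        HermiteMeans.IsDerivTower (n + 2) (Set.Ioi 0) (fun j => iteratedDeriv j φ) →
        (∀ x : ℝ, 0 < x → iteratedDeriv (n + 1) φ x ≠ 0) → 0 < a → a < b →
        HermiteMeans.IsMeanPoint φ m₁ m₂ a b (HermiteMeans.hermiteMean φ m₁ m₂ a b) := by
      intro φ a b hφ hφ0 ha hab
      have hsub : Set.Icc a b ⊆ Set.Ioi 0 := fun y hy => ha.trans_le hy.1
      rw [HermiteMeans.hermiteMean, if_neg hab.ne]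
      exact Classical.epsilon_spec (HermiteMeans.exists_isMeanPoint hab hm hN
        ((hφ.of_le (n + 1).le_succ).mono hsub)
        (fun y hy => (hφ (n + 1) (by omega) y (hsub hy)).continuousAt.continuousWithinAt)
        fun y hy => hφ0 y (hsub hy))
    have hprop : ∀ a ∈ Set.Ioi (0 : ℝ), iteratedDeriv (n + 1 + 1) g a =
        iteratedDeriv (n + 1) g a / iteratedDeriv (n + 1) f a * iteratedDeriv (n + 1 + 1) f a :=
      fun a ha => HermiteMeans.deriv_proportional_of_common_mean_points ha hm hN hF hG (hf0 a ha)
        fun b hab => ⟨_, hex hF hf0 ha hab,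
          h a b ha (lt_trans ha hab) ▸ hex hG hg0 ha hab⟩
    -- By `hprop`, the numerator in the quotient rule vanishes.
    have hratio : ∀ a ∈ Set.Ioi (0 : ℝ),
        HasDerivAt (fun x => iteratedDeriv (n + 1) g x / iteratedDeriv (n + 1) f x) 0 a := by
      intro a ha
      have hd := (hG (n + 1) (by omega) a ha).div (hF (n + 1) (by omega) a ha) (hf0 a ha)
      refine hd.congr_deriv ?_
      have := hf0 a ha
      simp only
      rw [hprop a ha]
      field_simp
      ring
    set c := iteratedDeriv (n + 1) g 1 / iteratedDeriv (n + 1) f 1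
    have hconst : ∀ x : ℝ, 0 < x → iteratedDeriv (n + 1) g x = c * iteratedDeriv (n + 1) f x := by
      intro x hx
      rw [← div_eq_iff (hf0 x hx)]
      exact isOpen_Ioi.is_const_of_deriv_eq_zero isPreconnected_Ioi
        (fun y hy => (hratio y hy).differentiableAt.differentiableWithinAt)
        (fun y hy => (hratio y hy).deriv) (Set.mem_Ioi.2 hx) (Set.mem_Ioi.2 one_pos)
    obtain ⟨p, hp, hpx⟩ := HermiteMeans.exists_polynomial_of_tower_eq_zero
      ((hG.sub (hF.const_mul c)).of_le (n + 1).le_succ)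
      (fun x hx => by rw [hconst x hx, sub_self])
    refine ⟨c, p, Polynomial.natDegree_le_of_degree_le (Order.lt_succ_iff.1 hp), fun x hx => ?_⟩
    have := hpx x hx
    simp only [iteratedDeriv_zero] at this
    linarith
  · rintro ⟨c, p, hp, hgf⟩ a b ha hb
    -- Otherwise `g` would agree with `p` on (0,∞) and its derivative of order n+1 would vanish.
    have hc : c ≠ 0 := by
      rintro rfl
      apply hg0 1 one_pos
      rw [HermiteMeans.iteratedDeriv_eq_of_eq_const_mul_add hF hgf (n + 1) (by omega) 1 one_pos,
        Polynomial.iterate_derivative_eq_zero (by omega)]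
      simp
    have hfg : ∀ x, 0 < x → f x = c⁻¹ * g x + (C (-c⁻¹) * p).eval x := by
      intro x hx
      rw [hgf x hx, Polynomial.eval_C_mul]
      field_simp
      ring
    -- Equal predicates have equal `Classical.epsilon` values, so uniqueness of the mean point is
    -- not needed.
    have hiff : HermiteMeans.IsMeanPoint f m₁ m₂ a b = HermiteMeans.IsMeanPoint g m₁ m₂ a b := by
      funext x
      exact propext ⟨fun hx => hx.const_mul_add hN ha hb (hF.of_le (by omega)) (by omega) hgf,
        fun hx => hx.const_mul_add hN ha hb (hG.of_le (by omega))
          ((Polynomial.natDegree_C_mul_le _ _).trans (by omega)) hfg⟩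
    rw [HermiteMeans.hermiteMean, HermiteMeans.hermiteMean, hiff]
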